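/- Let $F$ be a field of characteristic different from $2$. An algebra over $F$ is unital but not necessarily associative, and subalgebras contain the unit. For an $F$-algebra $A$ with an involution $*$ (a linear anti-automorphism of order dividing $2$) and $\gamma\in F\setminus\{0\}$, the Dickson double $D_\gamma(A)$ is the vector space $A\oplus iA$ with the multiplication $$(a+ib)(c+id)=(ac+\gamma\, d b^*)+i(a^*d+cb)$$ and the involution $(a+ib)^*=a^*-ib$. A Cayley algebra over $F$ is an algebra isomorphic to $D_\gamma(D_\beta(D_\alpha(F)))$ for some $\alpha,\beta,\gamma\in F\setminus\{0\}$, where $F$ carries the identity involution. For a subalgebra $H$ of a Cayley algebra (including the whole algebra) let $\mathrm{im}(H)=\{a\in H: a^2\in F1,\ a\notin F1\}\cup\{0\}$, which is a linear subspace. Let $O$ be a Cayley algebra over $F$, let $V=\mathrm{im}(O)$ and $$\mathcal B=\{\mathrm{im}(H): H \text{ is a 4-dimensional subalgebra of } O\}.$$ Then: 1. $(V,\mathcal B)$ is a $(7,3,2)$ $q$-covering design: $\dim V=7$, every element of $\mathcal B$ is a 3-dimensional subspace of $V$, and every 2-dimensional subspace of $V$ is contained in at least one element of $\mathcal B$.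 2. $\mathcal B$ is inclusion-minimal: no proper subset of $\mathcal B$ is a $(7,3,2)$ $q$-covering design on $V$. 3. $(V,\mathcal B)$ is a $2$-$(7,3,1)$ subspace design (a $q$-Fano plane), that is, $\dim V=7$, every element of $\mathcal B$ is 3-dimensional and every 2-dimensional subspace of $V$ is contained in exactly one element of $\mathcal B$, if and only if $O$ is a division algebra, that is, for every nonzero $a\in O$ the maps $x\mapsto ax$ and $x\mapsto xa$ are bijective. -/

import Mathlib

/-!
Algebras over a field `F` are unital, not necessarily associative: a `NonAssocRing A` with
`[Module F A] [IsScalarTower F A A] [SMulCommClass F A A]` (the multiplication is bilinear).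
-/

/-- An involution of the `F`-algebra `A`: a linear anti-automorphism of order dividing two. -/
class AlgInvolution (F A : Type*) [Field F] [NonAssocRing A] [Module F A] where
  conj : A →ₗ[F] A
  conj_mul : ∀ a b, conj (a * b) = conj b * conj a
  conj_conj : ∀ a, conj (conj a) = a

/-- The identity is the involution of the one-dimensional algebra `F`. -/
instance AlgInvolution.self (F : Type*) [Field F] : AlgInvolution F F where
  conj := LinearMap.id
  conj_mul a b := mul_comm a b
  conj_conj _ := rfl

@[simp] theorem AlgInvolution.conj_self {F : Type*} [Field F] (a : F) :
    AlgInvolution.conj (F := F) a = a := rfl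

/-- The Dickson double `D_γ(A) = A ⊕ i A`; the pair `⟨a, b⟩` stands for `a + i b`. -/
@[ext]
structure DicksonDouble {F : Type*} (γ : F) (A : Type*) where
  fst : A
  snd : A

/-- An involution fixes the unit. -/
theorem AlgInvolution.conj_one (F : Type*) {A : Type*} [Field F] [NonAssocRing A] [Module F A]
    [AlgInvolution F A] : AlgInvolution.conj (F := F) (1 : A) = 1 := by
  have h := AlgInvolution.conj_mul (F := F) (AlgInvolution.conj (F := F) (1 : A)) 1
  rw [mul_one, AlgInvolution.conj_conj, mul_one] at h
  exact h.symm

namespace DicksonDouble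

variable {F : Type*} {γ : F} {A : Type*} [NonAssocRing A]

instance : Zero (DicksonDouble γ A) := ⟨⟨0, 0⟩⟩
instance : One (DicksonDouble γ A) := ⟨⟨1, 0⟩⟩
instance : Add (DicksonDouble γ A) := ⟨fun x y => ⟨x.fst + y.fst, x.snd + y.snd⟩⟩
instance : Neg (DicksonDouble γ A) := ⟨fun x => ⟨-x.fst, -x.snd⟩⟩

@[simp] theorem fst_zero : (0 : DicksonDouble γ A).fst = 0 := rfl
@[simp] theorem snd_zero : (0 : DicksonDouble γ A).snd = 0 := rfl
@[simp] theorem fst_one : (1 : DicksonDouble γ A).fst = 1 := rfl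
@[simp] theorem snd_one : (1 : DicksonDouble γ A).snd = 0 := rfl
@[simp] theorem fst_add (x y : DicksonDouble γ A) : (x + y).fst = x.fst + y.fst := rfl
@[simp] theorem snd_add (x y : DicksonDouble γ A) : (x + y).snd = x.snd + y.snd := rfl
@[simp] theorem fst_neg (x : DicksonDouble γ A) : (-x).fst = -x.fst := rfl
@[simp] theorem snd_neg (x : DicksonDouble γ A) : (-x).snd = -x.snd := rfl

instance : AddCommGroup (DicksonDouble γ A) where
  add_assoc x y z := by ext <;> simp [add_assoc]
  zero_add x := by ext <;> simp
  add_zero x := by ext <;> simp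
  neg_add_cancel x := by ext <;> simp
  add_comm x y := by ext <;> simp [add_comm]
  nsmul := nsmulRec
  zsmul := zsmulRec

variable [Field F] [Module F A]

instance : SMul F (DicksonDouble γ A) := ⟨fun r x => ⟨r • x.fst, r • x.snd⟩⟩

@[simp] theorem fst_smul (r : F) (x : DicksonDouble γ A) : (r • x).fst = r • x.fst := rfl
@[simp] theorem snd_smul (r : F) (x : DicksonDouble γ A) : (r • x).snd = r • x.snd := rfl

/-- `(a + i b)(c + i d) = (a c + γ d b*) + i (a* d + c b)`. -/
instance [AlgInvolution F A] : Mul (DicksonDouble γ A) :=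
  ⟨fun x y =>
    ⟨x.fst * y.fst + γ • (y.snd * AlgInvolution.conj (F := F) x.snd),
     AlgInvolution.conj (F := F) x.fst * y.snd + y.fst * x.snd⟩⟩

@[simp] theorem fst_mul [AlgInvolution F A] (x y : DicksonDouble γ A) :
    (x * y).fst = x.fst * y.fst + γ • (y.snd * AlgInvolution.conj (F := F) x.snd) := rfl
@[simp] theorem snd_mul [AlgInvolution F A] (x y : DicksonDouble γ A) :
    (x * y).snd = AlgInvolution.conj (F := F) x.fst * y.snd + y.fst * x.snd := rfl

instance : Module F (DicksonDouble γ A) where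
  one_smul x := by ext <;> simp
  mul_smul r s x := by ext <;> simp [mul_smul]
  smul_zero r := by ext <;> simp
  smul_add r x y := by ext <;> simp
  add_smul r s x := by ext <;> simp [add_smul]
  zero_smul x := by ext <;> simp

instance [AlgInvolution F A] : NonAssocRing (DicksonDouble γ A) where
  left_distrib x y z := by ext <;> simp [mul_add, add_mul] <;> abel
  right_distrib x y z := by ext <;> simp [mul_add, add_mul] <;> abel
  zero_mul x := by ext <;> simp
  mul_zero x := by ext <;> simp
  one_mul x := by ext <;> simp [AlgInvolution.conj_one]
  mul_one x := by ext <;> simp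

instance [IsScalarTower F A A] [SMulCommClass F A A] [AlgInvolution F A] :
    IsScalarTower F (DicksonDouble γ A) (DicksonDouble γ A) where
  smul_assoc r x y := by
    ext <;> simp [smul_mul_assoc, mul_smul_comm, smul_comm γ r]

instance [IsScalarTower F A A] [SMulCommClass F A A] [AlgInvolution F A] :
    SMulCommClass F (DicksonDouble γ A) (DicksonDouble γ A) where
  smul_comm r x y := by
    ext <;> simp [smul_mul_assoc, mul_smul_comm, smul_comm γ r]

/-- The involution of the double: `(a + i b)* = a* - i b`. -/
instance [AlgInvolution F A] : AlgInvolution F (DicksonDouble γ A) where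
  conj :=
    { toFun := fun x => ⟨AlgInvolution.conj (F := F) x.fst, -x.snd⟩
      map_add' := fun x y => by ext <;> simp [add_comm]
      map_smul' := fun r x => by ext <;> simp }
  conj_mul x y := by
    ext <;> simp [AlgInvolution.conj_mul, AlgInvolution.conj_conj, add_comm]
  conj_conj x := by ext <;> simp [AlgInvolution.conj_conj]

@[simp] theorem fst_conj [AlgInvolution F A] (x : DicksonDouble γ A) :
    (AlgInvolution.conj (F := F) x).fst = AlgInvolution.conj (F := F) x.fst := rfl
@[simp] theorem snd_conj [AlgInvolution F A] (x : DicksonDouble γ A) :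
    (AlgInvolution.conj (F := F) x).snd = -x.snd := rfl

end DicksonDouble

/-- `O` is a Cayley algebra: an eight-dimensional Cayley-Dickson algebra, that is, `F` doubled
three times, with nonzero parameters (up to isomorphism of `F`-algebras). -/
def IsCayleyAlgebra (F O : Type*) [Field F] [NonAssocRing O] [Module F O] : Prop :=
  ∃ α β γ : F, α ≠ 0 ∧ β ≠ 0 ∧ γ ≠ 0 ∧
    ∃ e : O ≃ₗ[F] DicksonDouble γ (DicksonDouble β (DicksonDouble α F)),
      ∀ x y : O, e (x * y) = e x * e y

/-- `A` is a division algebra: left and right multiplication by each nonzero element of `A` are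
invertible. -/
def IsDivisionAlgebra (A : Type*) [NonAssocRing A] : Prop :=
  ∀ a : A, a ≠ 0 →
    Function.Bijective (fun x : A => a * x) ∧ Function.Bijective (fun x : A => x * a)

/-- A Cayley algebra is quadratic: `x² = t(x) x - n(x) 1` with `t` linear and `t(1) = 2`. -/
theorem IsCayleyAlgebra.quadratic {F O : Type*} [Field F] [NonAssocRing O] [Module F O]
    (hO : IsCayleyAlgebra F O) :
    ∃ (t : O →ₗ[F] F) (n : O → F), t 1 = 2 ∧ ∀ x : O, x * x = t x • x - n x • (1 : O) := by
  obtain ⟨α, β, γ, -, -, -, e, he⟩ := hO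
  have he1 : e 1 = 1 := by
    have h := he 1 (e.symm 1)
    rw [one_mul, e.apply_symm_apply, mul_one] at h
    exact h.symm
  refine ⟨{ toFun := fun x => 2 * (e x).fst.fst.fst
            map_add' := fun x y => by simp [mul_add]
            map_smul' := fun r x => by simp [mul_left_comm] },
    fun x => (e x).fst.fst.fst * (e x).fst.fst.fst - α * ((e x).fst.fst.snd * (e x).fst.fst.snd)
      - β * ((e x).fst.snd.fst * (e x).fst.snd.fst - α * ((e x).fst.snd.snd * (e x).fst.snd.snd))
      - γ * ((e x).snd.fst.fst * (e x).snd.fst.fst - α * ((e x).snd.fst.snd * (e x).snd.fst.snd)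
        - β * ((e x).snd.snd.fst * (e x).snd.snd.fst
          - α * ((e x).snd.snd.snd * (e x).snd.snd.snd))), ?_, ?_⟩
  · simp [he1]
  · intro x
    apply e.injective
    rw [he, map_sub, map_smul, map_smul, he1]
    dsimp only [LinearMap.coe_mk, AddHom.coe_mk]
    generalize e x = y
    ext <;> simp [sub_eq_add_neg] <;> ring

section Imaginary

variable {F O : Type*} [Field F] [NonAssocRing O] [Module F O]

/-- The imaginary elements of a unital subalgebra `H`: the elements `a` with `a² ∈ F1` but
`a ∉ F1`, together with `0`. -/
def imaginarySet (H : NonUnitalSubalgebra F O) : Set O :=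
  {a | a ∈ H ∧ (∃ c : F, a * a = c • (1 : O)) ∧ ¬ ∃ c : F, a = c • (1 : O)} ∪ {0}

/-- `im(H)` as a subspace of `O`. In a Cayley algebra it consists of the imaginary elements of `H`
only, see `coe_imaginary`. -/
def imaginary (H : NonUnitalSubalgebra F O) : Submodule F O :=
  Submodule.span F (imaginarySet H)

/-- In a Cayley algebra the imaginary elements of a subalgebra form a subspace. -/
theorem coe_imaginary (hF : ringChar F ≠ 2) (hO : IsCayleyAlgebra F O)
    (H : NonUnitalSubalgebra F O) : (imaginary H : Set O) = imaginarySet H := by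
  obtain ⟨t, n, ht1, hx⟩ := hO.quadratic
  have h2 : (2 : F) ≠ 0 := Ring.two_ne_zero hF
  have key : imaginarySet H = (H.toSubmodule ⊓ LinearMap.ker t : Submodule F O) := by
    ext a
    constructor
    · rintro (⟨haH, ⟨c, hc⟩, hna⟩ | h0)
      · refine ⟨haH, ?_⟩
        by_contra hta
        have hta' : t a ≠ 0 := hta
        apply hna
        refine ⟨(t a)⁻¹ * (c + n a), ?_⟩
        have h := hx a
        rw [hc, eq_sub_iff_add_eq, ← add_smul] at h
        rw [mul_smul, h, inv_smul_smul₀ hta']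
      · rw [Set.mem_singleton_iff] at h0
        subst h0
        exact Submodule.zero_mem _
    · rintro ⟨haH, hta⟩
      have hta' : t a = 0 := hta
      by_cases h1 : ∃ c : F, a = c • (1 : O)
      · right
        obtain ⟨c, rfl⟩ := h1
        rw [map_smul, ht1, smul_eq_mul, mul_eq_zero, or_iff_left h2] at hta'
        simp [hta']
      · left
        refine ⟨haH, ⟨-n a, ?_⟩, h1⟩
        rw [hx a, hta', zero_smul, zero_sub, neg_smul]
  rw [imaginary, key, Submodule.span_eq]

variable [IsScalarTower F O O] [SMulCommClass F O O]

variable (F O) in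
/-- `V = im(O)`. -/
def imaginarySpace : Submodule F O := imaginary ⊤

variable (F O) in
/-- The set of all `im(H)`, regarded as subspaces of `V = im(O)`, for `H` a four-dimensional
(unital) subalgebra of `O`. -/
def fourDimBlocks : Set (Submodule F (imaginarySpace F O)) :=
  {B | ∃ H : NonUnitalSubalgebra F O, (1 : O) ∈ H ∧ Module.finrank F H = 4 ∧
    B.map (imaginarySpace F O).subtype = imaginary H}

end Imaginary

section Designs

variable (F V : Type*) [Field F] [AddCommGroup V] [Module F V]

/-- `𝓑` is a `(v, k, t)` `q`-covering design on the `F`-vector space `V`. -/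
def IsQCoveringDesign (v k t : ℕ) (𝓑 : Set (Submodule F V)) : Prop :=
  Module.Finite F V ∧ Module.finrank F V = v ∧
  (∀ B ∈ 𝓑, Module.finrank F B = k) ∧
  ∀ T : Submodule F V, Module.finrank F T = t → ∃ B ∈ 𝓑, T ≤ B

/-- `𝓑` is a `t`-`(v, k, l)` subspace design on the `F`-vector space `V`. -/
def IsSubspaceDesign (t v k l : ℕ) (𝓑 : Set (Submodule F V)) : Prop :=
  Module.Finite F V ∧ Module.finrank F V = v ∧
  (∀ B ∈ 𝓑, Module.finrank F B = k) ∧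
  ∀ T : Submodule F V, Module.finrank F T = t → {B | B ∈ 𝓑 ∧ T ≤ B}.encard = l

end Designs

/-! Everything rests on the trace `t`, twice the real coordinate. The field `mul_add_mul` of
`IsCayleyTrace` is the polarised quadratic equation, with `t x * t y - t (x * y)` the polar form of
the norm, and `im(H)` is `H ∩ ker t`. Call an imaginary pair `x`, `y` generic if `1`, `x`, `y`, `x *
y` are independent. These four elements then span a subalgebra, and it is the only four-dimensional
one containing the pair. By `trichotomy` an independent pair that is not generic either has all its
products zero, or spans the plane of some `r`, `z` with `r * z = r`, `r² = 0`, `z² = 1`. In both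
cases a four-dimensional subalgebra is built by hand, which gives the covering. Minimality:
`exists_generic` finds a generic pair in each block, and the plane of that pair lies in no other
block. The obstruction to a 3-space without generic pairs is that annihilators of nonzero elements
are totally isotropic, so of dimension at most four. Uniqueness: without zero divisors nothing
nonzero squares to zero, so every independent pair is generic. With zero divisors there is an
imaginary `z` with `z² = 1`. For `r` in the `1`-eigenspace of right multiplication by `z`, each
nonzero imaginary `s` in the `-1`-eigenspace completes `1`, `z`, `r` to a subalgebra, and different
lines of `s` give different blocks through `⟨z, r⟩`. -/

/-- The properties of the trace of a Cayley algebra that are used below: the algebra is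
alternative, quadratic, of dimension eight, with an associative nondegenerate trace form. -/
structure IsCayleyTrace {F O : Type*} [Field F] [NonAssocRing O] [Module F O]
    (t : O →ₗ[F] F) : Prop where
  one : t 1 = 2
  left_alt : ∀ x y : O, x * (x * y) = (x * x) * y
  right_alt : ∀ x y : O, (x * y) * y = x * (y * y)
  mul_add_mul : ∀ x y, x * y + y * x = t x • y + t y • x - (t x * t y - t (x * y)) • (1 : O)
  comm : ∀ x y : O, t (x * y) = t (y * x)
  assoc : ∀ x y z, t ((x * y) * z) = t (x * (y * z))
  nondeg : ∀ x, (∀ y, t (x * y) = 0) → x = 0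
  finrank_eq : Module.finrank F O = 8

/-! ### Trace axioms for the triple Dickson double -/

/-- A Dickson double is the direct sum of two copies of the algebra. -/
def DicksonDouble.linearEquivProd {F A : Type*} [Field F] [NonAssocRing A] [Module F A] (γ : F) :
    DicksonDouble γ A ≃ₗ[F] A × A where
  toFun x := (x.fst, x.snd)
  invFun x := ⟨x.1, x.2⟩
  map_add' _ _ := rfl
  map_smul' _ _ := rfl
  left_inv _ := rfl
  right_inv _ := rfl

theorem DicksonDouble.finrank_eq {F A : Type*} [Field F] [NonAssocRing A] [Module F A]
    [Module.Finite F A] (γ : F) :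
    Module.finrank F (DicksonDouble γ A) = 2 * Module.finrank F A := by
  rw [(linearEquivProd γ).finrank_eq, Module.finrank_prod, two_mul]

instance {F A : Type*} [Field F] [NonAssocRing A] [Module F A] [Module.Finite F A] (γ : F) :
    Module.Finite F (DicksonDouble γ A) :=
  Module.Finite.equiv (DicksonDouble.linearEquivProd γ).symm

/-- Twice the real coordinate. -/
def DicksonDouble.trace {F : Type*} [Field F] (α β γ : F) :
    DicksonDouble γ (DicksonDouble β (DicksonDouble α F)) →ₗ[F] F where
  toFun x := 2 * x.fst.fst.fst
  map_add' x y := by simp [mul_add]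
  map_smul' r x := by simp [mul_left_comm]

theorem DicksonDouble.trace_apply {F : Type*} [Field F] {α β γ : F}
    (x : DicksonDouble γ (DicksonDouble β (DicksonDouble α F))) :
    trace α β γ x = 2 * x.fst.fst.fst := rfl

-- Polynomial identities in the coordinates. Once they are transported to `O`, only the axioms are
-- used.
set_option maxHeartbeats 1000000 in
theorem DicksonDouble.isCayleyTrace_trace {F : Type*} [Field F] (h2 : (2 : F) ≠ 0) {α β γ : F}
    (hα : α ≠ 0) (hβ : β ≠ 0) (hγ : γ ≠ 0) : IsCayleyTrace (trace α β γ) where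
  one := by simp [trace_apply]
  left_alt x y := by ext <;> simp <;> ring
  right_alt x y := by ext <;> simp <;> ring
  mul_add_mul x y := by
    ext <;> simp [sub_eq_add_neg, trace_apply] <;> ring
  comm x y := by simp [trace_apply, -mul_eq_mul_left_iff]; ring
  assoc x y z := by simp [trace_apply, -mul_eq_mul_left_iff]; ring
  nondeg x hx := by
    -- Pairing with the eight basis vectors reads off the coordinates of `x`, up to factors made of
    -- `2`, `α`, `β`, `γ` and signs.
    have h1 := hx ⟨⟨⟨1, 0⟩, 0⟩, 0⟩
    have h3 := hx ⟨⟨⟨0, 1⟩, 0⟩, 0⟩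
    have h4 := hx ⟨⟨0, ⟨1, 0⟩⟩, 0⟩
    have h5 := hx ⟨⟨0, ⟨0, 1⟩⟩, 0⟩
    have h6 := hx ⟨0, ⟨⟨1, 0⟩, 0⟩⟩
    have h7 := hx ⟨0, ⟨⟨0, 1⟩, 0⟩⟩
    have h8 := hx ⟨0, ⟨0, ⟨1, 0⟩⟩⟩
    have h9 := hx ⟨0, ⟨0, ⟨0, 1⟩⟩⟩
    simp [trace_apply, h2, hα, hβ, hγ] at h1 h3 h4 h5 h6 h7 h8 h9
    ext <;> simp [*]
  finrank_eq := by simp [DicksonDouble.finrank_eq]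

theorem IsCayleyAlgebra.exists_isCayleyTrace {F O : Type*} [Field F] [NonAssocRing O] [Module F O]
    (h2 : (2 : F) ≠ 0) (hO : IsCayleyAlgebra F O) : ∃ t : O →ₗ[F] F, IsCayleyTrace t := by
  obtain ⟨α, β, γ, hα, hβ, hγ, e, he⟩ := hO
  have he1 : e 1 = 1 := by
    have h := he 1 (e.symm 1)
    rw [one_mul, e.apply_symm_apply, mul_one] at h
    exact h.symm
  have hT := DicksonDouble.isCayleyTrace_trace h2 hα hβ hγ
  refine ⟨DicksonDouble.trace α β γ ∘ₗ e.toLinearMap, ?_, ?_, ?_, ?_, ?_, ?_, ?_, ?_⟩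
  · simpa [he1] using hT.one
  · exact fun x y => e.injective (by simpa [he] using hT.left_alt (e x) (e y))
  · exact fun x y => e.injective (by simpa [he] using hT.right_alt (e x) (e y))
  · exact fun x y => e.injective (by simpa [he, he1] using hT.mul_add_mul (e x) (e y))
  · exact fun x y => by simpa [he] using hT.comm (e x) (e y)
  · exact fun x y z => by simpa [he] using hT.assoc (e x) (e y) (e z)
  · intro x hx
    apply e.injective
    rw [map_zero]
    refine hT.nondeg _ fun y => ?_
    simpa [he] using hx (e.symm y)
  · rw [e.finrank_eq, hT.finrank_eq]

theorem Submodule.finrank_map_add_finrank_inf_ker {F V W : Type*} [Field F] [AddCommGroup V]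
    [Module F V] [AddCommGroup W] [Module F W] [Module.Finite F V] (p : Submodule F V)
    (f : V →ₗ[F] W) :
    Module.finrank F (p.map f) + Module.finrank F (p ⊓ LinearMap.ker f : Submodule F V) =
      Module.finrank F p := by
  rw [← LinearMap.finrank_range_add_finrank_ker (f.domRestrict p), LinearMap.range_domRestrict,
    LinearMap.ker_domRestrict, ← Submodule.map_comap_subtype, Submodule.finrank_map_subtype_eq]

/-! ### Linearised alternative laws, annihilators and eigenspaces -/

namespace IsCayleyTrace

variable {F O : Type*} [Field F] [NonAssocRing O] [Module F O] {t : O →ₗ[F] F}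

theorem finite (ht : IsCayleyTrace t) : Module.Finite F O :=
  Module.finite_of_finrank_pos (by rw [ht.finrank_eq]; norm_num)

theorem left_alt_add (ht : IsCayleyTrace t) (x y z : O) :
    x * (y * z) + y * (x * z) = (x * y + y * x) * z := by
  have h := ht.left_alt (x + y) z
  simp only [add_mul, mul_add, ht.left_alt] at h ⊢
  linear_combination (norm := module) (1 : ℤ) • h

theorem right_alt_add (ht : IsCayleyTrace t) (x y z : O) :
    (x * y) * z + (x * z) * y = x * (y * z + z * y) := by
  have h := ht.right_alt x (y + z)
  simp only [add_mul, mul_add, ht.right_alt] at h ⊢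
  linear_combination (norm := module) (1 : ℤ) • h

/-- Imaginary elements anticommute up to a scalar. -/
theorem mul_add_mul_of_trace_eq_zero (ht : IsCayleyTrace t) {x y : O} (hx : t x = 0)
    (hy : t y = 0) : x * y + y * x = t (x * y) • (1 : O) := by
  rw [ht.mul_add_mul, hx, hy]
  module

theorem exists_mul_self (ht : IsCayleyTrace t) (h2 : (2 : F) ≠ 0) {x : O} (hx : t x = 0) :
    ∃ c : F, x * x = c • (1 : O) := by
  refine ⟨t (x * x) / 2, ?_⟩
  have h := ht.mul_add_mul_of_trace_eq_zero hx hx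
  rw [← two_smul F] at h
  rw [div_eq_inv_mul, mul_smul, ← h, inv_smul_smul₀ h2]

variable [IsScalarTower F O O] [SMulCommClass F O O]

theorem exists_trace_mul_eq (ht : IsCayleyTrace t) (f : O →ₗ[F] F) :
    ∃ w, ∀ x, t (x * w) = f x := by
  have := ht.finite
  let τ : O →ₗ[F] Module.Dual F O := (LinearMap.mul F O).compr₂ t
  have hinj : Function.Injective τ := by
    rw [← LinearMap.ker_eq_bot, LinearMap.ker_eq_bot']
    exact fun x hx => ht.nondeg x fun y => LinearMap.congr_fun hx y
  obtain ⟨w, hw⟩ := (LinearMap.injective_iff_surjective_of_finrank_eq_finrank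
    Subspace.dual_finrank_eq.symm).1 hinj f
  exact ⟨w, fun x => by rw [ht.comm, ← hw]; rfl⟩

theorem exists_trace_mul_eq_one (ht : IsCayleyTrace t) {x y : O}
    (hxy : LinearIndependent F ![x, y]) : ∃ w, t (x * w) = 1 ∧ t (y * w) = 0 := by
  have hx : x ∉ Submodule.span F {y} := by
    rw [Submodule.mem_span_singleton]
    rintro ⟨a, ha⟩
    have := (LinearIndependent.pair_iff.1 hxy (-1) a (by rw [ha]; module)).1
    simp at this
  obtain ⟨f, hf, hfy⟩ := Submodule.exists_le_ker_of_notMem hx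
  obtain ⟨w, hw⟩ := ht.exists_trace_mul_eq ((f x)⁻¹ • f)
  have : f y = 0 := hfy (Submodule.mem_span_singleton_self y)
  exact ⟨w, by simp [hw, hf], by simp [hw, this]⟩

/-- A totally isotropic subspace has dimension at most four. -/
theorem finrank_le_four_of_isotropic (ht : IsCayleyTrace t)
    (K : Submodule F O) (hK : ∀ v ∈ K, ∀ w ∈ K, t v * t w - t (v * w) = 0) :
    Module.finrank F K ≤ 4 := by
  have := ht.finite
  -- The polar form of the norm. It is nondegenerate, so `B` carries `K` injectively into its
  -- annihilator, which has dimension `8 - dim K`.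
  let B : O →ₗ[F] Module.Dual F O := (LinearMap.mul F F).compl₁₂ t t - (LinearMap.mul F O).compr₂ t
  have hB : ∀ v w, B v w = t v * t w - t (v * w) := fun _ _ => rfl
  have hinj : LinearMap.ker B = ⊥ := by
    rw [LinearMap.ker_eq_bot']
    intro v hv
    have h : t v • (1 : O) - v = 0 := ht.nondeg _ fun y => by
      have := hB v y
      rw [hv] at this
      simpa [sub_mul] using this.symm
    have h' := congrArg t h
    simp only [map_sub, map_smul, ht.one, map_zero, smul_eq_mul] at h'
    have h0 : t v = 0 := by linear_combination h'
    simpa [h0] using h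
  have hle : K.map B ≤ K.dualAnnihilator := by
    rintro _ ⟨v, hv, rfl⟩
    rw [Submodule.mem_dualAnnihilator]
    exact fun w hw => hK v hv w hw
  have h1 := Submodule.finrank_mono hle
  have h3 := K.finrank_map_add_finrank_inf_ker B
  have h4 := Subspace.finrank_add_finrank_dualAnnihilator_eq K
  rw [hinj, inf_bot_eq, finrank_bot] at h3
  rw [ht.finrank_eq] at h4
  omega

/-- If `a * v = a * w = 0`, then `a * (v * w + w * v) = 0`. Expanding the bracket leaves the polar
norm of `v`, `w` times `a`, so the annihilator is totally isotropic. -/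
theorem finrank_ker_mulLeft_le (ht : IsCayleyTrace t) {a : O} (ha : a ≠ 0) :
    Module.finrank F (LinearMap.ker (LinearMap.mulLeft F a)) ≤ 4 := by
  refine ht.finrank_le_four_of_isotropic _ fun v hv w hw => ?_
  rw [LinearMap.mem_ker, LinearMap.mulLeft_apply] at hv hw
  have h := ht.right_alt_add a v w
  rw [ht.mul_add_mul, mul_sub, mul_add, mul_smul_comm, mul_smul_comm, mul_smul_comm, hv, hw] at h
  simpa [ha] using h

theorem finrank_ker_mulRight_le (ht : IsCayleyTrace t) {a : O} (ha : a ≠ 0) :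
    Module.finrank F (LinearMap.ker (LinearMap.mulRight F a)) ≤ 4 := by
  refine ht.finrank_le_four_of_isotropic _ fun v hv w hw => ?_
  rw [LinearMap.mem_ker, LinearMap.mulRight_apply] at hv hw
  have h := ht.left_alt_add v w a
  rw [ht.mul_add_mul, sub_mul, add_mul, smul_mul_assoc, smul_mul_assoc, smul_mul_assoc, hv, hw] at h
  simpa [ha] using h

-- Linearised left alternativity moves `x` past `w`. Multiplication by `w` thus nearly inverts `x`
-- on its annihilator.
omit [SMulCommClass F O O] in
theorem mul_mul_eq_smul (ht : IsCayleyTrace t) {x c : O} (hx : t x = 0) (hc : x * c = 0) (w : O) :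
    x * (w * c) = t (x * w) • c := by
  have h := ht.left_alt_add x w c
  rw [ht.mul_add_mul, sub_mul, add_mul, smul_mul_assoc, smul_mul_assoc, smul_mul_assoc, hc, hx] at h
  simpa using h

/-- Two independent imaginary elements that span a null subalgebra have only a plane of common
right annihilators. -/
theorem finrank_inf_ker_mulLeft_le (ht : IsCayleyTrace t) {x y : O}
    (hx : t x = 0) (hy : t y = 0) (hxy : LinearIndependent F ![x, y]) :
    Module.finrank F (LinearMap.ker (LinearMap.mulLeft F y) ⊓
      LinearMap.ker (LinearMap.mulLeft F x) : Submodule F O) ≤ 2 := by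
  have := ht.finite
  obtain ⟨w, hw1, hw0⟩ := ht.exists_trace_mul_eq_one hxy
  -- With `t (x * w) = 1` and `t (y * w) = 0`, each common annihilator is `c = x * (w * c)` with `y
  -- * (w * c) = 0`. So the kernel of `x` on `ker y` also lies in the image of `ker y` under `x`,
  -- and twice its dimension is at most `4`.
  have hle : LinearMap.ker (LinearMap.mulLeft F y) ⊓ LinearMap.ker (LinearMap.mulLeft F x) ≤
      (LinearMap.ker (LinearMap.mulLeft F y)).map (LinearMap.mulLeft F x) := by
    rintro c ⟨hyc, hxc⟩
    simp only [SetLike.mem_coe, LinearMap.mem_ker, LinearMap.mulLeft_apply] at hyc hxc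
    refine ⟨w * c, ?_, ?_⟩
    · simp [ht.mul_mul_eq_smul hy hyc, hw0]
    · simp [ht.mul_mul_eq_smul hx hxc, hw1]
  have h1 := Submodule.finrank_mono hle
  have h3 := Submodule.finrank_map_add_finrank_inf_ker (LinearMap.ker (LinearMap.mulLeft F y))
    (LinearMap.mulLeft F x)
  have h4 := ht.finrank_ker_mulLeft_le (a := y) (by simpa using hxy.ne_zero 1)
  omega

/-- No three independent vectors `x`, `y`, `u` exist with `x`, `y` imaginary and null and `u`
annihilated by both of them. -/
theorem not_linearIndependent_of_mul_eq_zero (ht : IsCayleyTrace t)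
    {x y u : O} (hx : t x = 0) (hy : t y = 0) (hxx : x * x = 0) (hyy : y * y = 0)
    (hxy : x * y = 0) (hyx : y * x = 0) (hxu : x * u = 0) (hyu : y * u = 0) :
    ¬ LinearIndependent F ![x, y, u] := by
  intro h
  have := ht.finite
  have hp : LinearIndependent F ![x, y] := by
    convert h.comp ![(0 : Fin 3), 1] (by decide) using 1
    ext i; fin_cases i <;> rfl
  have hle : Submodule.span F (Set.range ![x, y, u]) ≤
      (LinearMap.ker (LinearMap.mulLeft F y) ⊓ LinearMap.ker (LinearMap.mulLeft F x)) := by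
    rw [Submodule.span_le]
    rintro _ ⟨i, rfl⟩
    fin_cases i <;> simp [*]
  have h1 := Submodule.finrank_mono hle
  rw [finrank_span_eq_card h] at h1
  have := ht.finrank_inf_ker_mulLeft_le hx hy hp
  simp at h1
  omega

/-- The `-1`-eigenspace of right multiplication by an imaginary square root of `1`. -/
theorem exists_linearIndependent_mul_eq_neg (ht : IsCayleyTrace t) (h2 : (2 : F) ≠ 0) {z : O}
    (hz : t z = 0) (hzz : z * z = 1) :
    ∃ s₁ s₂ : O, LinearIndependent F ![s₁, s₂] ∧ t s₁ = 0 ∧ t s₂ = 0 ∧ s₁ * z = -s₁ ∧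
      s₂ * z = -s₂ := by
  have := ht.finite
  -- Two trace conditions cut the dimension to at least `6`, and right multiplication by `1 - z`
  -- kills at most `4`. The image of `U` is imaginary and lies in the `-1`-eigenspace, because `(w *
  -- (1 - z)) * z = w * z - w`.
  let U : Submodule F O := (⊤ ⊓ LinearMap.ker t) ⊓ LinearMap.ker (t ∘ₗ LinearMap.mulRight F z)
  have hU : 6 ≤ Module.finrank F U := by
    have h1 := Submodule.finrank_map_add_finrank_inf_ker ⊤ t
    have h3 := Submodule.finrank_map_add_finrank_inf_ker (⊤ ⊓ LinearMap.ker t)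
      (t ∘ₗ LinearMap.mulRight F z)
    rw [finrank_top, ht.finrank_eq] at h1
    have h4 := Submodule.finrank_le ((⊤ : Submodule F O).map t)
    have h5 := Submodule.finrank_le (((⊤ : Submodule F O) ⊓ LinearMap.ker t).map
      (t ∘ₗ LinearMap.mulRight F z))
    rw [Module.finrank_self] at h4 h5
    change 6 ≤ Module.finrank F (⊤ ⊓ LinearMap.ker t ⊓ LinearMap.ker (t ∘ₗ LinearMap.mulRight F z) :
      Submodule F O)
    omega
  have hz1 : 1 - z ≠ 0 := by
    intro h
    have := congrArg t h
    simp [ht.one, hz, h2] at this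
  have h1 := U.finrank_map_add_finrank_inf_ker (LinearMap.mulRight F (1 - z))
  have h3 := Submodule.finrank_mono (inf_le_right :
    U ⊓ LinearMap.ker (LinearMap.mulRight F (1 - z)) ≤ _)
  have h4 := ht.finrank_ker_mulRight_le hz1
  have h5 : 1 < Module.finrank F (U.map (LinearMap.mulRight F (1 - z))) := by omega
  have hmem : ∀ s ∈ U.map (LinearMap.mulRight F (1 - z)), t s = 0 ∧ s * z = -s := by
    rintro _ ⟨w, ⟨⟨-, hw1⟩, hw2⟩, rfl⟩
    simp only [SetLike.mem_coe, LinearMap.mem_ker, LinearMap.comp_apply,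
      LinearMap.mulRight_apply] at hw1 hw2
    constructor
    · simp [mul_sub, hw1, hw2]
    · simp [mul_sub, sub_mul, ht.right_alt, hzz]
  have := Module.nontrivial_of_finrank_pos (zero_lt_one.trans h5)
  obtain ⟨s, hs⟩ := exists_ne (0 : U.map (LinearMap.mulRight F (1 - z)))
  obtain ⟨s', hs'⟩ := exists_linearIndependent_pair_of_one_lt_finrank h5 hs
  refine ⟨s, s', ?_, (hmem s s.2).1, (hmem s' s'.2).1, (hmem s s.2).2, (hmem s' s'.2).2⟩
  rw [LinearIndependent.pair_iff] at hs' ⊢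
  exact fun a b hab => hs' a b (Subtype.ext (by simpa using hab))

end IsCayleyTrace

/-! ### The span of two imaginary elements and the trichotomy -/

namespace IsCayleyTrace

variable {F O : Type*} [Field F] [NonAssocRing O] [Module F O] {t : O →ₗ[F] F}

theorem exists_mul_self_eq (ht : IsCayleyTrace t) (h2 : (2 : F) ≠ 0) (x : O) :
    ∃ c : F, x * x = t x • x - c • (1 : O) := by
  refine ⟨2⁻¹ * (t x * t x - t (x * x)), ?_⟩
  have h := ht.mul_add_mul x x
  rw [← two_smul F (x * x), ← two_smul F (t x • x)] at h
  have h' := congrArg (fun a => (2 : F)⁻¹ • a) h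
  simpa only [smul_sub, inv_smul_smul₀ h2, mul_smul] using h'

theorem eq_zero_of_smul_one_add (ht : IsCayleyTrace t) (h2 : (2 : F) ≠ 0) {x y : O}
    (hx : t x = 0) (hy : t y = 0) (hxy : LinearIndependent F ![x, y]) {a b c : F}
    (h : a • (1 : O) + b • x + c • y = 0) : a = 0 ∧ b = 0 ∧ c = 0 := by
  have ha : a = 0 := by simpa [ht.one, hx, hy, h2] using congrArg t h
  refine ⟨ha, LinearIndependent.pair_iff.1 hxy b c ?_⟩
  rwa [ha, zero_smul, zero_add] at h

theorem linearIndependent_of_notMem_span (ht : IsCayleyTrace t) (h2 : (2 : F) ≠ 0) {x y : O}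
    (hx : t x = 0) (hy : t y = 0) (hxy : LinearIndependent F ![x, y])
    (h : x * y ∉ Submodule.span F {1, x, y}) : LinearIndependent F ![1, x, y, x * y] := by
  rw [Fintype.linearIndependent_iff]
  intro g hg
  simp only [Fin.sum_univ_four, Matrix.cons_val] at hg
  have h3 : g 3 = 0 := by
    by_contra h3
    apply h
    rw [Submodule.mem_span_triple]
    refine ⟨-(g 3)⁻¹ * g 0, -(g 3)⁻¹ * g 1, -(g 3)⁻¹ * g 2, ?_⟩
    rw [← inv_smul_smul₀ h3 (x * y), eq_neg_of_add_eq_zero_right hg]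
    module
  rw [h3, zero_smul, add_zero] at hg
  obtain ⟨h0, h1, h2'⟩ := ht.eq_zero_of_smul_one_add h2 hx hy hxy hg
  intro i
  fin_cases i <;> assumption

/-- The subspace spanned by `1`, `x`, `y` and `x * y`. -/
abbrev quaternionSpan (F : Type*) {O : Type*} [Field F] [NonAssocRing O] [Module F O] (x y : O) :
    Submodule F O :=
  Submodule.span F (Set.range ![1, x, y, x * y])

theorem mem_quaternionSpan {x y a : O} :
    a ∈ quaternionSpan F x y ↔
      ∃ p q r s : F, p • (1 : O) + q • x + r • y + s • (x * y) = a := by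
  rw [quaternionSpan, Submodule.mem_span_range_iff_exists_fun]
  constructor
  · rintro ⟨g, rfl⟩
    exact ⟨g 0, g 1, g 2, g 3, by simp [Fin.sum_univ_four]⟩
  · rintro ⟨p, q, r, s, rfl⟩
    exact ⟨![p, q, r, s], by simp [Fin.sum_univ_four]⟩

variable [IsScalarTower F O O] [SMulCommClass F O O]

/-- The alternative laws and `y * x = t (x * y) - x * y` reduce all products of the four spanning
elements, so the span is closed whether or not the pair is generic. -/
theorem mul_mem_quaternionSpan (ht : IsCayleyTrace t) (h2 : (2 : F) ≠ 0) {x y : O}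
    (hx : t x = 0) (hy : t y = 0) {a b : O} (ha : a ∈ quaternionSpan F x y)
    (hb : b ∈ quaternionSpan F x y) : a * b ∈ quaternionSpan F x y := by
  obtain ⟨p, hp⟩ := ht.exists_mul_self h2 hx
  obtain ⟨q, hq⟩ := ht.exists_mul_self h2 hy
  set k := t (x * y) with hk
  have hyx : y * x = k • (1 : O) - x * y :=
    eq_sub_of_add_eq' (ht.mul_add_mul_of_trace_eq_zero hx hy)
  have h1 : x * (x * y) = p • y := by rw [ht.left_alt, hp, smul_mul_assoc, one_mul]
  have h3 : (x * y) * y = q • x := by rw [ht.right_alt, hq, mul_smul_comm, mul_one]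
  have h4 : y * (x * y) = k • y - q • x := by
    have h := ht.left_alt y x
    rw [hyx, hq, smul_mul_assoc, one_mul, mul_sub, mul_smul_comm, mul_one] at h
    rw [← h, sub_sub_cancel]
  have h5 : (x * y) * x = k • x - p • y := by
    have h := ht.right_alt y x
    rw [hyx, hp, mul_smul_comm, mul_one, sub_mul, smul_mul_assoc, one_mul] at h
    rw [← h, sub_sub_cancel]
  obtain ⟨c, h6⟩ := ht.exists_mul_self_eq h2 (x * y)
  rw [← hk] at h6
  refine LinearMap.BilinMap.apply_apply_mem_of_mem_span (quaternionSpan F x y) _ _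
    (LinearMap.mul F O) ?_ a b ha hb
  rintro _ ⟨i, rfl⟩ _ ⟨j, rfl⟩
  rw [LinearMap.mul_apply', mem_quaternionSpan]
  fin_cases i <;> fin_cases j <;>
    simp only [Fin.mk_zero, Fin.mk_one, Fin.reduceFinMk, Matrix.cons_val, one_mul,
      mul_one, hp, hq, hyx, h1, h3, h4, h5, h6]
  -- The multiplication table of `1`, `x`, `y`, `x * y`, row by row.
  · exact ⟨1, 0, 0, 0, by module⟩
  · exact ⟨0, 1, 0, 0, by module⟩
  · exact ⟨0, 0, 1, 0, by module⟩
  · exact ⟨0, 0, 0, 1, by module⟩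
  · exact ⟨0, 1, 0, 0, by module⟩
  · exact ⟨p, 0, 0, 0, by module⟩
  · exact ⟨0, 0, 0, 1, by module⟩
  · exact ⟨0, 0, p, 0, by module⟩
  · exact ⟨0, 0, 1, 0, by module⟩
  · exact ⟨k, 0, 0, -1, by module⟩
  · exact ⟨q, 0, 0, 0, by module⟩
  · exact ⟨0, -q, k, 0, by module⟩
  · exact ⟨0, 0, 0, 1, by module⟩
  · exact ⟨0, k, -p, 0, by module⟩
  · exact ⟨0, q, 0, 0, by module⟩
  · exact ⟨-c, 0, 0, k, by module⟩

/-- A generic pair of imaginary elements generates a four-dimensional subalgebra. -/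
theorem exists_subalgebra_of_linearIndependent (ht : IsCayleyTrace t) (h2 : (2 : F) ≠ 0) {x y : O}
    (hx : t x = 0) (hy : t y = 0) (h : LinearIndependent F ![1, x, y, x * y]) :
    ∃ H : NonUnitalSubalgebra F O, (1 : O) ∈ H ∧ Module.finrank F H = 4 ∧ x ∈ H ∧ y ∈ H := by
  let H : NonUnitalSubalgebra F O :=
    { quaternionSpan F x y with
      mul_mem' := fun ha hb => ht.mul_mem_quaternionSpan h2 hx hy ha hb }
  refine ⟨H, Submodule.subset_span ⟨0, rfl⟩, ?_, Submodule.subset_span ⟨1, rfl⟩,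
    Submodule.subset_span ⟨2, rfl⟩⟩
  exact (finrank_span_eq_card h).trans (by simp)

omit [IsScalarTower F O O] [SMulCommClass F O O] in
theorem toSubmodule_eq_quaternionSpan [Module.Finite F O] {H : NonUnitalSubalgebra F O}
    (h1 : (1 : O) ∈ H) (hH : Module.finrank F H = 4) {x y : O} (hx : x ∈ H) (hy : y ∈ H)
    (h : LinearIndependent F ![1, x, y, x * y]) : H.toSubmodule = quaternionSpan F x y := by
  refine (Submodule.eq_of_le_of_finrank_eq ?_ ?_).symm
  · rw [quaternionSpan, Submodule.span_le]
    rintro _ ⟨i, rfl⟩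
    fin_cases i
    exacts [h1, hx, hy, H.mul_mem hx hy]
  · exact (finrank_span_eq_card h).trans ((Fintype.card_fin 4).trans hH.symm)

/-- If `r`, `z` are independent imaginary elements with `r * z = c + δ r` then `c = 0`, `r` is null
and `z² = δ²`. -/
theorem eq_zero_of_mul_eq (ht : IsCayleyTrace t) (h2 : (2 : F) ≠ 0) {r z : O}
    (hr : t r = 0) (hz : t z = 0) (hrz : LinearIndependent F ![r, z]) {c δ : F}
    (h : r * z = c • (1 : O) + δ • r) :
    c = 0 ∧ r * r = 0 ∧ z * z = (δ * δ) • (1 : O) := by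
  obtain ⟨p, hp⟩ := ht.exists_mul_self h2 hr
  obtain ⟨q, hq⟩ := ht.exists_mul_self h2 hz
  have hl := ht.left_alt r z
  have hr' := ht.right_alt r z
  rw [h, hp, mul_add, mul_smul_comm, mul_one, mul_smul_comm, hp, smul_mul_assoc, one_mul] at hl
  rw [h, hq, add_mul, smul_mul_assoc, one_mul, smul_mul_assoc, h, mul_smul_comm, mul_one] at hr'
  -- Coefficients of `r * (r * z) = r² z`, and after it of `(r * z) * z = r z²`.
  obtain ⟨-, h3, h4⟩ := ht.eq_zero_of_smul_one_add h2 hr hz hrz (a := δ * p) (b := c) (c := -p)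
    (by linear_combination (norm := module) (1 : ℤ) • hl)
  obtain ⟨-, h5, -⟩ := ht.eq_zero_of_smul_one_add h2 hr hz hrz (a := δ * c) (b := δ * δ - q)
    (c := c) (by linear_combination (norm := module) (1 : ℤ) • hr')
  refine ⟨h3, ?_, ?_⟩
  · rw [hp, neg_eq_zero.1 h4, zero_smul]
  · rw [hq, sub_eq_zero.1 h5]

/-- A pair of independent imaginary elements is generic, or null, or spans the same plane as some
`r`, `z` with `r * z = r`, `r² = 0` and `z² = 1`. -/
theorem trichotomy (ht : IsCayleyTrace t) (h2 : (2 : F) ≠ 0) {x y : O}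
    (hx : t x = 0) (hy : t y = 0) (hxy : LinearIndependent F ![x, y]) :
    LinearIndependent F ![1, x, y, x * y] ∨
    (x * x = 0 ∧ y * y = 0 ∧ x * y = 0 ∧ y * x = 0) ∨
    ∃ r z : O, r * z = r ∧ r * r = 0 ∧ z * z = 1 ∧ LinearIndependent F ![r, z] ∧
      (∃ a b : F, r = a • x + b • y) ∧ (∃ a b : F, z = a • x + b • y) ∧
      (∃ a b : F, x = a • r + b • z) ∧ (∃ a b : F, y = a • r + b • z) := by
  by_cases h : x * y ∈ Submodule.span F {1, x, y}
  swap
  · exact Or.inl (ht.linearIndependent_of_notMem_span h2 hx hy hxy h)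
  right
  rw [Submodule.mem_span_triple] at h
  obtain ⟨a, α, β, h⟩ := h
  obtain ⟨p, hp⟩ := ht.exists_mul_self h2 hx
  obtain ⟨q, hq⟩ := ht.exists_mul_self h2 hy
  have hyx : y * x = t (x * y) • (1 : O) - x * y :=
    eq_sub_of_add_eq' (ht.mul_add_mul_of_trace_eq_zero hx hy)
  by_cases hβ : β = 0
  · by_cases hα : α = 0
    · left
      subst hα hβ
      obtain ⟨h3, h4, h5⟩ := ht.eq_zero_of_mul_eq h2 hx hy hxy (c := a) (δ := 0)
        (by rw [← h]; module)
      have h6 : x * y = 0 := by rw [← h, h3]; module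
      refine ⟨h4, by rw [h5]; module, h6, ?_⟩
      rw [hyx, h6, map_zero, zero_smul, sub_zero]
    · right
      subst hβ
      have hzy : α⁻¹ • y = (0 : F) • x + α⁻¹ • y := by module
      have hli : LinearIndependent F ![x, α⁻¹ • y] := by
        rw [LinearIndependent.pair_iff] at hxy ⊢
        intro c d hcd
        have := hxy c (d * α⁻¹) (by rw [mul_smul, hcd])
        simpa [hα] using this
      have hmul : x * (α⁻¹ • y) = (α⁻¹ * a) • (1 : O) + (1 : F) • x := by
        rw [mul_smul_comm, ← h, zero_smul, add_zero, smul_add, inv_smul_smul₀ hα]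
        module
      obtain ⟨h3, h4, h5⟩ := ht.eq_zero_of_mul_eq h2 hx (by simp [hy]) hli hmul
      rw [h3, zero_smul, zero_add, one_smul] at hmul
      rw [mul_one, one_smul] at h5
      refine ⟨x, α⁻¹ • y, hmul, h4, h5, hli, ⟨1, 0, by module⟩, ⟨0, α⁻¹, by module⟩,
        ⟨1, 0, by module⟩, ⟨0, α, ?_⟩⟩
      rw [smul_inv_smul₀ hα, zero_smul, zero_add]
  · right
    -- From `x * y = a + α x + β y`, the choice `r = α x + β y`, `z = -β⁻¹ x` makes `r * z - r` a
    -- scalar, since `y * x` is `-(x * y)` up to a scalar.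
    have hli : LinearIndependent F ![α • x + β • y, (-β⁻¹) • x] := by
      rw [LinearIndependent.pair_iff] at hxy ⊢
      intro c d hcd
      have := hxy (c * α - d * β⁻¹) (c * β) (by rw [← hcd]; module)
      have hc : c = 0 := by simpa [hβ] using this.2
      simpa [hc, hβ] using this
    have hmul : (α • x + β • y) * ((-β⁻¹) • x) =
        (-β⁻¹ * (α * p + β * (t (x * y) - a))) • (1 : O) + (1 : F) • (α • x + β • y) := by
      rw [mul_smul_comm, add_mul, smul_mul_assoc, smul_mul_assoc, hp, hyx]
      generalize t (x * y) = k
      rw [← h]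
      match_scalars <;> field_simp
    obtain ⟨h3, h4, h5⟩ := ht.eq_zero_of_mul_eq h2 (by simp [hx, hy]) (by simp [hx]) hli hmul
    rw [h3, zero_smul, zero_add, one_smul] at hmul
    rw [mul_one, one_smul] at h5
    refine ⟨_, _, hmul, h4, h5, hli, ⟨α, β, rfl⟩, ⟨-β⁻¹, 0, by module⟩,
      ⟨0, -β, ?_⟩, ⟨β⁻¹, α, ?_⟩⟩
    · match_scalars <;> field_simp <;> ring
    · match_scalars <;> field_simp; ring

end IsCayleyTrace

/-! ### Four-dimensional subalgebras through non-generic pairs -/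

namespace IsCayleyTrace

variable {F O : Type*} [Field F] [NonAssocRing O] [Module F O] {t : O →ₗ[F] F}

theorem mul_eq_neg_mul (ht : IsCayleyTrace t) {x y : O} (hx : t x = 0) (hy : t y = 0)
    (hxy : t (x * y) = 0) : y * x = -(x * y) := by
  have h := ht.mul_add_mul_of_trace_eq_zero hx hy
  rw [hxy, zero_smul] at h
  exact (neg_eq_of_add_eq_zero_right h).symm

theorem finrank_inf_ker_add_one (ht : IsCayleyTrace t) (h2 : (2 : F) ≠ 0) (p : Submodule F O)
    (hp : 1 ∈ p) : Module.finrank F (p ⊓ LinearMap.ker t : Submodule F O) + 1 =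
      Module.finrank F p := by
  have := ht.finite
  have h := p.finrank_map_add_finrank_inf_ker t
  have h1 : p.map t = ⊤ := by
    rw [eq_top_iff]
    rintro c -
    exact ⟨(c / 2) • 1, p.smul_mem _ hp, by simp [ht.one, h2]⟩
  rw [h1, finrank_top, Module.finrank_self] at h
  omega

variable [IsScalarTower F O O] [SMulCommClass F O O]

-- The trace kills `a`. The trace after right multiplication by `z` kills `b`. Sum and difference of
-- the relation with its product by `z` then separate the eigenvectors `r` and `s`.
omit [SMulCommClass F O O] in
theorem eq_zero_of_eigenvectors (ht : IsCayleyTrace t) (h2 : (2 : F) ≠ 0) {z r s : O}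
    (hz : t z = 0) (hr : t r = 0) (hs : t s = 0) (hzz : z * z = 1) (hrz : r * z = r)
    (hsz : s * z = -s) (hr0 : r ≠ 0) (hs0 : s ≠ 0) {a b c d : F}
    (h : a • (1 : O) + b • z + c • r + d • s = 0) : a = 0 ∧ b = 0 ∧ c = 0 ∧ d = 0 := by
  have ha : a = 0 := by simpa [ht.one, hz, hr, hs, h2] using congrArg t h
  have h' := congrArg (· * z) h
  simp only [add_mul, smul_mul_assoc, one_mul, hzz, hrz, hsz, zero_mul] at h'
  have hb : b = 0 := by simpa [ht.one, hz, hr, hs, h2] using congrArg t h'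
  subst ha hb
  have hc : (2 * c) • r = 0 := by linear_combination (norm := module) (1 : ℤ) • (h + h')
  have hd : (2 * d) • s = 0 := by linear_combination (norm := module) (1 : ℤ) • (h - h')
  simp only [smul_eq_zero, mul_eq_zero, h2, hr0, hs0, or_false, false_or] at hc hd
  exact ⟨rfl, rfl, hc, hd⟩

/-- The pair `z`, `r + s` is generic: `z * (r + s) = s - r`, and `2` is invertible. The freedom in
`s` is what later defeats uniqueness. -/
theorem exists_subalgebra_of_eigenvectors (ht : IsCayleyTrace t) (h2 : (2 : F) ≠ 0) {z r s : O}
    (hz : t z = 0) (hr : t r = 0) (hs : t s = 0) (hzz : z * z = 1) (hrz : r * z = r)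
    (hsz : s * z = -s) (hr0 : r ≠ 0) (hs0 : s ≠ 0) :
    ∃ H : NonUnitalSubalgebra F O, (1 : O) ∈ H ∧ Module.finrank F H = 4 ∧ z ∈ H ∧ r ∈ H ∧ s ∈ H ∧
      ∀ x ∈ H, ∃ a b c d : F, x = a • (1 : O) + b • z + c • r + d • s := by
  have := ht.finite
  have hzr : z * r = -r := by rw [ht.mul_eq_neg_mul hr hz (by rw [hrz, hr]), hrz]
  have hzs : z * s = s := by
    rw [ht.mul_eq_neg_mul hs hz (by rw [hsz, map_neg, hs, neg_zero]), hsz, neg_neg]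
  have hmul : z * (r + s) = s - r := by rw [mul_add, hzr, hzs]; abel
  have hli : LinearIndependent F ![1, z, r + s, z * (r + s)] := by
    rw [Fintype.linearIndependent_iff, hmul]
    intro g hg
    simp only [Fin.sum_univ_four, Matrix.cons_val] at hg
    obtain ⟨h0, h1, h3, h4⟩ := ht.eq_zero_of_eigenvectors h2 hz hr hs hzz hrz hsz hr0 hs0
      (a := g 0) (b := g 1) (c := g 2 - g 3) (d := g 2 + g 3) (by rw [← hg]; module)
    have h5 : g 2 = 0 := (mul_eq_zero_iff_left h2).1 (by linear_combination h3 + h4)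
    have h6 : g 3 = 0 := by linear_combination h4 - h5
    intro i
    fin_cases i <;> assumption
  obtain ⟨H, h1, hH, hzH, hrs⟩ := ht.exists_subalgebra_of_linearIndependent h2 hz
    (by rw [map_add, hr, hs, add_zero]) hli
  have hsr : s - r ∈ H := hmul ▸ H.mul_mem hzH hrs
  refine ⟨H, h1, hH, hzH, ?_, ?_, ?_⟩
  · have : r = (2⁻¹ : F) • ((r + s) - (s - r)) := by match_scalars <;> field_simp <;> ring
    rw [this]
    exact H.smul_mem _ (sub_mem hrs hsr)
  · have : s = (2⁻¹ : F) • ((r + s) + (s - r)) := by match_scalars <;> field_simp <;> ring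
    rw [this]
    exact H.smul_mem _ (add_mem hrs hsr)
  · intro x hx
    rw [← NonUnitalSubalgebra.mem_toSubmodule, toSubmodule_eq_quaternionSpan h1 hH hzH hrs hli,
      mem_quaternionSpan] at hx
    obtain ⟨a, b, c, d, rfl⟩ := hx
    exact ⟨a, b, c - d, c + d, by rw [hmul]; module⟩

/-- With `t (x * w) = 1` and `t (y * w) = 0`, the element `q = w * x` acts like a matrix unit: `x *
q = x`, `q * x = 0`, `y * q = 0`, `q * y = y`. Its imaginary part `q - 1/2` forms a generic pair
with `x + y`. -/
theorem exists_subalgebra_of_null (ht : IsCayleyTrace t) (h2 : (2 : F) ≠ 0) {x y : O}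
    (hx : t x = 0) (hy : t y = 0) (hxy : LinearIndependent F ![x, y]) (hxx : x * x = 0)
    (hyy : y * y = 0) (hxy0 : x * y = 0) (hyx : y * x = 0) :
    ∃ H : NonUnitalSubalgebra F O, (1 : O) ∈ H ∧ Module.finrank F H = 4 ∧ x ∈ H ∧ y ∈ H := by
  obtain ⟨w, hw1, hw0⟩ := ht.exists_trace_mul_eq_one hxy
  have hx0 : x ≠ 0 := by simpa using hxy.ne_zero 0
  have hy0 : y ≠ 0 := by simpa using hxy.ne_zero 1
  have hxq : x * (w * x) = x := by rw [ht.mul_mul_eq_smul hx hxx, hw1, one_smul]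
  have hyq : y * (w * x) = 0 := by rw [ht.mul_mul_eq_smul hy hyx, hw0, zero_smul]
  have hqx : (w * x) * x = 0 := by rw [ht.right_alt, hxx, mul_zero]
  have htq : t (w * x) = 1 := by rw [ht.comm, hw1]
  have hqy : (w * x) * y = y := by
    have h := ht.mul_add_mul y (w * x)
    rw [hyq, hy, htq, map_zero] at h
    linear_combination (norm := module) (1 : ℤ) • h
  set q := w * x
  obtain ⟨e, he⟩ : ∃ e : F, 2 * e = 1 := ⟨2⁻¹, mul_inv_cancel₀ h2⟩
  have htq' : t (q - e • 1) = 0 := by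
    rw [map_sub, map_smul, htq, ht.one, smul_eq_mul, mul_comm, he, sub_self]
  have hmul : (q - e • 1) * (x + y) = -(e • x) + (1 - e) • y := by
    simp only [mul_add, sub_mul, hqx, hqy, smul_mul_assoc, one_mul]
    module
  have hli : LinearIndependent F ![1, q - e • 1, x + y, (q - e • 1) * (x + y)] := by
    rw [Fintype.linearIndependent_iff, hmul]
    intro g hg
    simp only [Fin.sum_univ_four, Matrix.cons_val] at hg
    -- Left multiplication by `x` and by `y` kills the nilpotent terms and isolates the first two
    -- coefficients.
    have hgx := congrArg (x * ·) hg
    have hgy := congrArg (y * ·) hg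
    simp only [mul_add, mul_sub, mul_neg, mul_smul_comm, mul_one, hxq, hyq, hxx, hyy, hxy0, hyx,
      mul_zero] at hgx hgy
    have h1 : g 0 + g 1 - g 1 * e = 0 := by
      apply (smul_eq_zero_iff_left hx0).1
      rw [← hgx]; module
    have h3 : g 0 - g 1 * e = 0 := by
      apply (smul_eq_zero_iff_left hy0).1
      rw [← hgy]; module
    have h4 : g 1 = 0 := by linear_combination h1 - h3
    have h5 : g 0 = 0 := by rw [h4] at h3; simpa using h3
    rw [h4, h5] at hg
    obtain ⟨h6, h7⟩ := LinearIndependent.pair_iff.1 hxy (g 2 - g 3 * e) (g 2 + g 3 * (1 - e))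
      (by rw [← hg]; module)
    have h8 : g 3 = 0 := by linear_combination h7 - h6
    have h9 : g 2 = 0 := by rw [h8] at h6; simpa using h6
    intro i
    fin_cases i <;> assumption
  obtain ⟨H, h1, hH, hqH, hxyH⟩ := ht.exists_subalgebra_of_linearIndependent h2 htq'
    (by rw [map_add, hx, hy, add_zero]) hli
  have hyH : y ∈ H := by
    have : y = (q - e • 1) * (x + y) + e • (x + y) := by rw [hmul]; module
    rw [this]
    exact add_mem (H.mul_mem hqH hxyH) (H.smul_mem _ hxyH)
  exact ⟨H, h1, hH, by simpa using sub_mem hxyH hyH, hyH⟩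

/-- Any two imaginary elements lie in a four-dimensional subalgebra. -/
theorem exists_subalgebra (ht : IsCayleyTrace t) (h2 : (2 : F) ≠ 0) {x y : O}
    (hx : t x = 0) (hy : t y = 0) (hxy : LinearIndependent F ![x, y]) :
    ∃ H : NonUnitalSubalgebra F O, (1 : O) ∈ H ∧ Module.finrank F H = 4 ∧ x ∈ H ∧ y ∈ H := by
  rcases ht.trichotomy h2 hx hy hxy with h | ⟨hxx, hyy, hxy0, hyx⟩ |
    ⟨r, z, hrz, -, hzz, hli, ⟨a, b, hr⟩, ⟨a', b', hz⟩, ⟨c, d, hx'⟩, ⟨c', d', hy'⟩⟩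
  · exact ht.exists_subalgebra_of_linearIndependent h2 hx hy h
  · exact ht.exists_subalgebra_of_null h2 hx hy hxy hxx hyy hxy0 hyx
  · have htz : t z = 0 := by simp [hz, hx, hy]
    obtain ⟨s, s', hs, hts, -, hsz, -⟩ := ht.exists_linearIndependent_mul_eq_neg h2 htz hzz
    obtain ⟨H, h1, hH, hzH, hrH, -⟩ := ht.exists_subalgebra_of_eigenvectors h2 htz
      (by simp [hr, hx, hy]) hts hzz hrz hsz (by simpa using hli.ne_zero 0)
      (by simpa using hs.ne_zero 0)
    exact ⟨H, h1, hH, hx' ▸ add_mem (H.smul_mem _ hrH) (H.smul_mem _ hzH),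
      hy' ▸ add_mem (H.smul_mem _ hrH) (H.smul_mem _ hzH)⟩

/-! ### Generic pairs in imaginary 3-spaces -/

/-- Every imaginary three-dimensional subspace that contains a pair `r`, `z` with `r * z = r`,
`z² = 1` contains a generic pair. -/
theorem exists_generic_of_eigenvector (ht : IsCayleyTrace t) (h2 : (2 : F) ≠ 0)
    {W : Submodule F O} (hW : W ≤ LinearMap.ker t) (hW3 : Module.finrank F W = 3) {r z : O}
    (hr : r ∈ W) (hz : z ∈ W) (hrz : r * z = r) (hrr : r * r = 0) (hzz : z * z = 1)
    (hli : LinearIndependent F ![r, z]) :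
    ∃ x ∈ W, ∃ y ∈ W, LinearIndependent F ![1, x, y, x * y] := by
  by_contra! hng
  have hmul : ∀ x ∈ W, ∀ y ∈ W, LinearIndependent F ![x, y] →
      ∃ a b c : F, a • (1 : O) + b • x + c • y = x * y := by
    intro x hx y hy hxy
    rw [← Submodule.mem_span_triple]
    by_contra h
    exact hng x hx y hy (ht.linearIndependent_of_notMem_span h2 (hW hx) (hW hy) hxy h)
  have htr : t r = 0 := hW hr
  have htz : t z = 0 := hW hz
  obtain ⟨s, hs, hs'⟩ : ∃ s ∈ W, s ∉ Submodule.span F (Set.range ![r, z]) := by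
    by_contra! hle
    have := ht.finite
    have h := Submodule.finrank_mono (show W ≤ _ from hle)
    rw [hW3, finrank_span_eq_card hli, Fintype.card_fin] at h
    omega
  have hts : t s = 0 := hW hs
  have hli3 := hli.finSnoc hs'
  have ind : ∀ a b c d : F, a • (1 : O) + b • r + c • z + d • s = 0 →
      a = 0 ∧ b = 0 ∧ c = 0 ∧ d = 0 := by
    intro a b c d h
    have ha : a = 0 := by simpa [ht.one, htz, htr, hts, h2] using congrArg t h
    have h3 := Fintype.linearIndependent_iff.1 hli3 ![b, c, d] (by
      rw [Fin.sum_univ_three, ← h, ha, zero_smul, zero_add]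
      rfl)
    exact ⟨ha, h3 0, h3 1, h3 2⟩
  obtain ⟨a, b, c, h1⟩ := hmul s hs z hz (LinearIndependent.pair_iff.2 fun p q h => by
    obtain ⟨-, -, h3, h4⟩ := ind 0 0 q p (by rw [← h]; module)
    exact ⟨h4, h3⟩)
  obtain ⟨a', b', c', h1'⟩ := hmul (r + s) (add_mem hr hs) z hz
    (LinearIndependent.pair_iff.2 fun p q h => by
      obtain ⟨-, -, h3, h4⟩ := ind 0 p q p (by rw [← h]; module)
      exact ⟨h4, h3⟩)
  -- Comparing `s * z` with `(r + s) * z` forces the coefficient of `s` in `s * z` to be `1`, as for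
  -- `r`. Then `v = s + c z` satisfies `v * z = v` and `v² = 0`.
  rw [add_mul, hrz, ← h1] at h1'
  obtain ⟨-, hb1, -, hb2⟩ := ind (a' - a) (b' - 1) (c' - c) (b' - b)
    (by linear_combination (norm := module) (1 : ℤ) • h1')
  have hb : b = 1 := by linear_combination hb1 - hb2
  subst hb
  have hvW : s + c • z ∈ W := add_mem hs (W.smul_mem _ hz)
  have hvz : (s + c • z) * z = (a + c) • (1 : O) + (1 : F) • (s + c • z) := by
    rw [add_mul, smul_mul_assoc, hzz, ← h1]
    module
  obtain ⟨hac, hvv, -⟩ := ht.eq_zero_of_mul_eq h2 (hW hvW) htz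
    (LinearIndependent.pair_iff.2 fun p q h => by
      obtain ⟨-, -, h3, h4⟩ := ind 0 0 (p * c + q) p (by rw [← h]; module)
      exact ⟨h4, by simpa [h4] using h3⟩) hvz
  rw [hac, zero_smul, zero_add, one_smul] at hvz
  have htv : t (s + c • z) = 0 := hW hvW
  obtain ⟨α, β, γ, h3⟩ := hmul r hr (s + c • z) hvW (LinearIndependent.pair_iff.2 fun p q h => by
      obtain ⟨-, h3, -, h4⟩ := ind 0 p (q * c) q (by rw [← h]; module)
      exact ⟨h3, h4⟩)
  have hzv : z * (s + c • z) = -(s + c • z) := by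
    rw [ht.mul_eq_neg_mul htv htz (by rw [hvz, htv]), hvz]
  -- As `v * z + z * v = 0`, this reads `(r * v) * z + r * v = 0`, which forces `r * v = 0`.
  have h4 := ht.right_alt_add r (s + c • z) z
  rw [hvz, hzv, add_neg_cancel, mul_zero, hrz, ← h3, add_mul, add_mul, smul_mul_assoc,
    smul_mul_assoc, smul_mul_assoc, one_mul, hrz, hvz] at h4
  obtain ⟨hα, hβ, -, hγ⟩ := ind α (2 * β) (α + 2 * (γ * c)) (2 * γ)
    (by linear_combination (norm := module) (1 : ℤ) • h4)
  replace hβ : β = 0 := by simpa [h2] using hβ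
  replace hγ : γ = 0 := by simpa [h2] using hγ
  have hrv : r * (s + c • z) = 0 := by rw [← h3, hα, hβ, hγ]; module
  have hvr : (s + c • z) * r = 0 := by
    rw [ht.mul_eq_neg_mul htr htv (by rw [hrv, map_zero]), hrv, neg_zero]
  -- Both `r` and `v` are fixed by `z` on the right, so `z - 1` is the third common annihilator.
  refine ht.not_linearIndependent_of_mul_eq_zero htr htv hrr hvv hrv hvr (u := z - 1)
    (by rw [mul_sub, hrz, mul_one, sub_self]) (by rw [mul_sub, hvz, mul_one, sub_self]) ?_
  rw [Fintype.linearIndependent_iff]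
  intro g hg
  simp only [Fin.sum_univ_three, Matrix.cons_val] at hg
  obtain ⟨h5, h6, -, h7⟩ := ind (-g 2) (g 0) (g 1 * c + g 2) (g 1) (by rw [← hg]; module)
  rw [neg_eq_zero] at h5
  intro i
  fin_cases i <;> assumption

/-- Every imaginary three-dimensional subspace contains a generic pair. -/
theorem exists_generic (ht : IsCayleyTrace t) (h2 : (2 : F) ≠ 0)
    {W : Submodule F O} (hW : W ≤ LinearMap.ker t) (hW3 : Module.finrank F W = 3) :
    ∃ x ∈ W, ∃ y ∈ W, LinearIndependent F ![1, x, y, x * y] := by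
  by_contra! hng
  have hnull : ∀ x ∈ W, ∀ y ∈ W, LinearIndependent F ![x, y] →
      x * x = 0 ∧ y * y = 0 ∧ x * y = 0 ∧ y * x = 0 := by
    intro x hx y hy hxy
    rcases ht.trichotomy h2 (hW hx) (hW hy) hxy with h | h |
      ⟨r, z, hrz, hrr, hzz, hli, ⟨a, b, hr⟩, ⟨a', b', hz⟩, -⟩
    · exact (hng x hx y hy h).elim
    · exact h
    · obtain ⟨x', hx', y', hy', h⟩ := ht.exists_generic_of_eigenvector h2 hW hW3
        (hr ▸ add_mem (W.smul_mem _ hx) (W.smul_mem _ hy))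
        (hz ▸ add_mem (W.smul_mem _ hx) (W.smul_mem _ hy)) hrz hrr hzz hli
      exact (hng x' hx' y' hy' h).elim
  -- All independent pairs now have zero products, so a basis of `W` consists of three common
  -- annihilators of its first two vectors.
  have := ht.finite
  let v := Module.finBasisOfFinrankEq F W hW3
  have hli := v.linearIndependent.map' W.subtype W.ker_subtype
  have hv : LinearIndependent F ![(v 0 : O), v 1, v 2] := by
    have e : ![(v 0 : O), v 1, v 2] = W.subtype ∘ v := by
      ext i; fin_cases i <;> rfl
    rw [e]
    exact hli
  have pair : ∀ i j : Fin 3, i ≠ j → LinearIndependent F ![(v i : O), v j] := by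
    intro i j hij
    have e : ![(v i : O), v j] = (W.subtype ∘ v) ∘ ![i, j] := by
      ext k; fin_cases k <;> rfl
    rw [e]
    refine hli.comp _ fun p q hpq => ?_
    fin_cases p <;> fin_cases q <;> simp_all [eq_comm]
  obtain ⟨h00, h11, h01, h10⟩ := hnull _ (v 0).2 _ (v 1).2 (pair 0 1 (by decide))
  obtain ⟨-, -, h02, -⟩ := hnull _ (v 0).2 _ (v 2).2 (pair 0 2 (by decide))
  obtain ⟨-, -, h12, -⟩ := hnull _ (v 1).2 _ (v 2).2 (pair 1 2 (by decide))
  exact ht.not_linearIndependent_of_mul_eq_zero (hW (v 0).2) (hW (v 1).2) h00 h11 h01 h10 h02 h12 hv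

end IsCayleyTrace

/-! ### Blocks as trace-zero parts of subalgebras -/

namespace IsCayleyTrace

variable {F O : Type*} [Field F] [NonAssocRing O] [Module F O] {t : O →ₗ[F] F}

theorem imaginarySet_eq (ht : IsCayleyTrace t) (h2 : (2 : F) ≠ 0) (H : NonUnitalSubalgebra F O) :
    imaginarySet H = (H.toSubmodule ⊓ LinearMap.ker t : Submodule F O) := by
  ext a
  constructor
  · rintro (⟨haH, ⟨c, hc⟩, hna⟩ | h0)
    · refine ⟨haH, ?_⟩
      by_contra hta
      obtain ⟨d, hd⟩ := ht.exists_mul_self_eq h2 a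
      refine hna ⟨(t a)⁻¹ * (c + d), ?_⟩
      rw [hc, eq_sub_iff_add_eq, ← add_smul] at hd
      rw [mul_smul, hd, inv_smul_smul₀ hta]
    · rw [Set.mem_singleton_iff.1 h0]
      exact Submodule.zero_mem _
  · rintro ⟨haH, hta⟩
    have hta' : t a = 0 := hta
    by_cases h1 : ∃ c : F, a = c • (1 : O)
    · right
      obtain ⟨c, rfl⟩ := h1
      rw [map_smul, ht.one, smul_eq_mul, mul_eq_zero, or_iff_left h2] at hta'
      simp [hta']
    · exact Or.inl ⟨haH, ht.exists_mul_self h2 hta', h1⟩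

theorem imaginary_eq (ht : IsCayleyTrace t) (h2 : (2 : F) ≠ 0) (H : NonUnitalSubalgebra F O) :
    imaginary H = H.toSubmodule ⊓ LinearMap.ker t := by
  rw [imaginary, ht.imaginarySet_eq h2, Submodule.span_eq]

theorem mem_imaginary (ht : IsCayleyTrace t) (h2 : (2 : F) ≠ 0) (H : NonUnitalSubalgebra F O)
    {x : O} : x ∈ imaginary H ↔ x ∈ H ∧ t x = 0 := by
  rw [ht.imaginary_eq h2]
  rfl

variable [IsScalarTower F O O] [SMulCommClass F O O]

theorem imaginarySpace_eq (ht : IsCayleyTrace t) (h2 : (2 : F) ≠ 0) :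
    imaginarySpace F O = LinearMap.ker t := by
  rw [imaginarySpace, ht.imaginary_eq h2]
  exact top_inf_eq _

theorem trace_coe (ht : IsCayleyTrace t) (h2 : (2 : F) ≠ 0) (x : imaginarySpace F O) :
    t x = 0 :=
  (ht.imaginarySpace_eq h2).le x.2

theorem finrank_imaginarySpace (ht : IsCayleyTrace t) (h2 : (2 : F) ≠ 0) :
    Module.finrank F (imaginarySpace F O) = 7 := by
  have h := ht.finrank_inf_ker_add_one h2 ⊤ Submodule.mem_top
  rw [top_inf_eq, finrank_top, ht.finrank_eq, ← ht.imaginarySpace_eq h2] at h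
  omega

theorem finrank_block (ht : IsCayleyTrace t) (h2 : (2 : F) ≠ 0)
    {B : Submodule F (imaginarySpace F O)} (hB : B ∈ fourDimBlocks F O) :
    Module.finrank F B = 3 := by
  obtain ⟨H, h1, hH, hBH⟩ := hB
  have h := ht.finrank_inf_ker_add_one h2 H.toSubmodule h1
  rw [← ht.imaginary_eq h2, ← hBH, Submodule.finrank_map_subtype_eq] at h
  have : Module.finrank F H.toSubmodule = 4 := hH
  omega

theorem mem_block_iff (ht : IsCayleyTrace t) (h2 : (2 : F) ≠ 0)
    {B : Submodule F (imaginarySpace F O)} {H : NonUnitalSubalgebra F O}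
    (hBH : B.map (imaginarySpace F O).subtype = imaginary H) (x : imaginarySpace F O) :
    x ∈ B ↔ (x : O) ∈ H := by
  have h : x ∈ B ↔ (x : O) ∈ B.map (imaginarySpace F O).subtype := by simp
  rw [h, hBH, ht.mem_imaginary h2, and_iff_left (ht.trace_coe h2 x)]

/-- The block of a four-dimensional subalgebra. -/
theorem exists_block (ht : IsCayleyTrace t) (h2 : (2 : F) ≠ 0) {H : NonUnitalSubalgebra F O}
    (h1 : (1 : O) ∈ H) (hH : Module.finrank F H = 4) :
    ∃ B ∈ fourDimBlocks F O, ∀ x : imaginarySpace F O, x ∈ B ↔ (x : O) ∈ H := by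
  have hB : ((imaginary H).comap (imaginarySpace F O).subtype).map (imaginarySpace F O).subtype =
      imaginary H := by
    rw [Submodule.map_comap_subtype, inf_eq_right, ht.imaginarySpace_eq h2, ht.imaginary_eq h2]
    exact inf_le_right
  exact ⟨_, ⟨H, h1, hH, hB⟩, ht.mem_block_iff h2 hB⟩

/-- A block is determined by any generic pair in it. -/
theorem block_ext (ht : IsCayleyTrace t) (h2 : (2 : F) ≠ 0)
    {B B' : Submodule F (imaginarySpace F O)} (hB : B ∈ fourDimBlocks F O)
    (hB' : B' ∈ fourDimBlocks F O) {x y : imaginarySpace F O} (hx : x ∈ B) (hy : y ∈ B)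
    (hx' : x ∈ B') (hy' : y ∈ B') (h : LinearIndependent F ![(1 : O), x, y, x * y]) : B = B' := by
  have := ht.finite
  obtain ⟨H, h1, hH, hBH⟩ := hB
  obtain ⟨H', h1', hH', hBH'⟩ := hB'
  rw [ht.mem_block_iff h2 hBH] at hx hy
  rw [ht.mem_block_iff h2 hBH'] at hx' hy'
  ext v
  rw [ht.mem_block_iff h2 hBH, ht.mem_block_iff h2 hBH', ← NonUnitalSubalgebra.mem_toSubmodule,
    ← NonUnitalSubalgebra.mem_toSubmodule, toSubmodule_eq_quaternionSpan h1 hH hx hy h,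
    toSubmodule_eq_quaternionSpan h1' hH' hx' hy' h]

end IsCayleyTrace

theorem Submodule.exists_pair_of_finrank_eq_two {F V : Type*} [Field F] [AddCommGroup V]
    [Module F V] {T : Submodule F V} (hT : Module.finrank F T = 2) :
    ∃ x y : V, LinearIndependent F ![x, y] ∧ T = span F {x, y} := by
  have : Module.Finite F T := Module.finite_of_finrank_pos (by omega)
  let v := Module.finBasisOfFinrankEq F T hT
  have e : ![(v 0 : V), v 1] = T.subtype ∘ v := by
    ext i; fin_cases i <;> rfl
  refine ⟨v 0, v 1, ?_, ?_⟩
  · rw [e]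
    exact v.linearIndependent.map' T.subtype T.ker_subtype
  · rw [← Matrix.range_cons_cons_empty, e, Set.range_comp, Submodule.span_image, v.span_eq,
      Submodule.map_subtype_top]

theorem LinearIndependent.coe_pair {F V : Type*} [Field F] [AddCommGroup V] [Module F V]
    {W : Submodule F V} {x y : W} (h : LinearIndependent F ![x, y]) :
    LinearIndependent F ![(x : V), (y : V)] := by
  rw [LinearIndependent.pair_iff] at h ⊢
  exact fun a b hab => h a b (Subtype.ext (by simpa using hab))

/-! ### Covering, minimality and uniqueness -/

namespace IsCayleyTrace

variable {F O : Type*} [Field F] [NonAssocRing O] [Module F O] {t : O →ₗ[F] F}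
variable [IsScalarTower F O O] [SMulCommClass F O O]

theorem exists_block_ge (ht : IsCayleyTrace t) (h2 : (2 : F) ≠ 0)
    {T : Submodule F (imaginarySpace F O)} (hT : Module.finrank F T = 2) :
    ∃ B ∈ fourDimBlocks F O, T ≤ B := by
  obtain ⟨x, y, hxy, rfl⟩ := Submodule.exists_pair_of_finrank_eq_two hT
  obtain ⟨H, h1, hH, hx, hy⟩ := ht.exists_subalgebra h2 (ht.trace_coe h2 x) (ht.trace_coe h2 y)
    hxy.coe_pair
  obtain ⟨B, hB, hmem⟩ := ht.exists_block h2 h1 hH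
  refine ⟨B, hB, ?_⟩
  rw [Submodule.span_le]
  rintro _ (rfl | rfl)
  exacts [(hmem _).2 hx, (hmem _).2 hy]

theorem isQCoveringDesign (ht : IsCayleyTrace t) (h2 : (2 : F) ≠ 0) :
    IsQCoveringDesign F (imaginarySpace F O) 7 3 2 (fourDimBlocks F O) :=
  have := ht.finite
  ⟨inferInstance, ht.finrank_imaginarySpace h2, fun _ hB => ht.finrank_block h2 hB,
    fun _ hT => ht.exists_block_ge h2 hT⟩

theorem finrank_span_pair {V : Type*} [AddCommGroup V] [Module F V] {x y : V}
    (h : LinearIndependent F ![x, y]) : Module.finrank F (Submodule.span F {x, y}) = 2 := by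
  rw [← Matrix.range_cons_cons_empty x y ![], finrank_span_eq_card h, Fintype.card_fin]

/-- A generic pair in `B` spans a plane that no other block contains, so `B` cannot be dropped. -/
theorem not_isQCoveringDesign_of_ssubset (ht : IsCayleyTrace t) (h2 : (2 : F) ≠ 0)
    {S : Set (Submodule F (imaginarySpace F O))} (hS : S ⊂ fourDimBlocks F O) :
    ¬ IsQCoveringDesign F (imaginarySpace F O) 7 3 2 S := by
  rintro ⟨-, -, -, hcov⟩
  refine hS.2 fun B hB => ?_
  have hle : B.map (imaginarySpace F O).subtype ≤ LinearMap.ker t := by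
    rw [← ht.imaginarySpace_eq h2]
    exact Submodule.map_subtype_le _ _
  obtain ⟨_, ⟨x, hx, rfl⟩, _, ⟨y, hy, rfl⟩, h⟩ := ht.exists_generic h2 hle
    (by rw [Submodule.finrank_map_subtype_eq, ht.finrank_block h2 hB])
  have hxy : LinearIndependent F ![x, y] := by
    rw [LinearIndependent.pair_iff]
    intro a b hab
    have h' := Fintype.linearIndependent_iff.1 h ![0, a, b, 0] (by
      simpa [Fin.sum_univ_four] using congrArg Subtype.val hab)
    exact ⟨h' 1, h' 2⟩
  obtain ⟨B', hB', hT⟩ := hcov _ (finrank_span_pair hxy)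
  rw [ht.block_ext h2 hB (hS.1 hB') hx hy (hT (Submodule.subset_span (by simp)))
    (hT (Submodule.subset_span (by simp))) h]
  exact hB'

theorem isSubspaceDesign_of_isDivisionAlgebra (ht : IsCayleyTrace t) (h2 : (2 : F) ≠ 0)
    (hO : IsDivisionAlgebra O) :
    IsSubspaceDesign F (imaginarySpace F O) 2 7 3 1 (fourDimBlocks F O) := by
  have := ht.finite
  refine ⟨inferInstance, ht.finrank_imaginarySpace h2, fun _ hB => ht.finrank_block h2 hB,
    fun T hT => ?_⟩
  obtain ⟨B, hB, hTB⟩ := ht.exists_block_ge h2 hT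
  obtain ⟨x, y, hxy, rfl⟩ := Submodule.exists_pair_of_finrank_eq_two hT
  have hnil : ∀ a : O, a * a = 0 → a = 0 := by
    intro a ha
    by_contra ha0
    exact ha0 ((hO a ha0).1.1 (by simp [ha]))
  have hli : LinearIndependent F ![(1 : O), x, y, x * y] := by
    rcases ht.trichotomy h2 (ht.trace_coe h2 x) (ht.trace_coe h2 y) hxy.coe_pair with
      h | ⟨hxx, -⟩ | ⟨r, z, -, hrr, -, hli, -⟩
    · exact h
    · exact (hxy.coe_pair.ne_zero 0 (hnil _ hxx)).elim
    · exact (hli.ne_zero 0 (hnil _ hrr)).elim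
  rw [Nat.cast_one, Set.encard_eq_one]
  refine ⟨B, Set.eq_singleton_iff_unique_mem.2 ⟨⟨hB, hTB⟩, ?_⟩⟩
  rintro B' ⟨hB', hTB'⟩
  rw [Submodule.span_le, Set.insert_subset_iff, Set.singleton_subset_iff] at hTB hTB'
  exact ht.block_ext h2 hB' hB hTB'.1 hTB'.2 hTB.1 hTB.2 hli

theorem isDivisionAlgebra_of_mul_ne_zero (ht : IsCayleyTrace t)
    (h : ∀ a b : O, a ≠ 0 → b ≠ 0 → a * b ≠ 0) : IsDivisionAlgebra O := by
  have := ht.finite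
  intro a ha
  have hl : Function.Injective (LinearMap.mulLeft F a) :=
    (injective_iff_map_eq_zero _).2 fun b hb => not_not.1 fun hb0 => h a b ha hb0 hb
  have hr : Function.Injective (LinearMap.mulRight F a) :=
    (injective_iff_map_eq_zero _).2 fun b hb => not_not.1 fun hb0 => h b a hb0 ha hb
  exact ⟨⟨hl, LinearMap.injective_iff_surjective.1 hl⟩, ⟨hr, LinearMap.injective_iff_surjective.1 hr⟩⟩

-- A left zero divisor has norm zero: in `a * (a * b) = a² b` only the norm of `a` times `b`
-- survives.
omit [SMulCommClass F O O] in
theorem mul_self_eq_trace_smul (ht : IsCayleyTrace t) (h2 : (2 : F) ≠ 0) {a b : O} (hb : b ≠ 0)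
    (hab : a * b = 0) : a * a = t a • a := by
  obtain ⟨c, hc⟩ := ht.exists_mul_self_eq h2 a
  have h := ht.left_alt a b
  rw [hab, mul_zero, hc, sub_mul, smul_mul_assoc, hab, smul_mul_assoc, one_mul, smul_zero,
    zero_sub, eq_comm, neg_eq_zero, smul_eq_zero, or_iff_left hb] at h
  rw [hc, h, zero_smul, sub_zero]

/-- A Cayley algebra with zero divisors has an imaginary square root of `1`. -/
theorem exists_mul_self_eq_one (ht : IsCayleyTrace t) (h2 : (2 : F) ≠ 0) {a b : O} (ha : a ≠ 0)
    (hb : b ≠ 0) (hab : a * b = 0) : ∃ z : O, t z = 0 ∧ z * z = 1 := by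
  have key : ∀ a : O, a * a = t a • a → t a ≠ 0 → ∃ z : O, t z = 0 ∧ z * z = 1 := by
    intro a ha hta
    -- Here `e = a / t a` is an idempotent of trace `1`, and `2 e - 1` squares to `1`.
    refine ⟨(2 * (t a)⁻¹) • a - 1, ?_, ?_⟩
    · simp [ht.one, hta]
    · simp only [sub_mul, mul_sub, smul_mul_assoc, mul_smul_comm, ha, one_mul, mul_one]
      match_scalars <;> field_simp
      ring
  have haa := ht.mul_self_eq_trace_smul h2 hb hab
  by_cases hta : t a = 0
  · obtain ⟨w, hw⟩ : ∃ w, t (a * w) ≠ 0 := by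
      by_contra! h
      exact ha (ht.nondeg a h)
    -- Since `a² = 0`, also `(w * a) * a = 0`. So `w * a` is again a zero divisor, now of nonzero
    -- trace.
    refine key (w * a) (ht.mul_self_eq_trace_smul h2 ha ?_) (by rwa [ht.comm])
    rw [ht.right_alt, haa, hta, zero_smul, mul_zero]
  · exact key a haa hta

theorem isDivisionAlgebra_of_isSubspaceDesign (ht : IsCayleyTrace t) (h2 : (2 : F) ≠ 0)
    (hD : IsSubspaceDesign F (imaginarySpace F O) 2 7 3 1 (fourDimBlocks F O)) :
    IsDivisionAlgebra O := by
  refine ht.isDivisionAlgebra_of_mul_ne_zero fun a b ha hb hab => ?_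
  obtain ⟨z, hz, hzz⟩ := ht.exists_mul_self_eq_one h2 ha hb hab
  -- The `-1`-eigenspace of `-z` is the `1`-eigenspace of `z`.
  obtain ⟨r, r', hr', hr, -, hrz, -⟩ := ht.exists_linearIndependent_mul_eq_neg h2 (z := -z)
    (by simp [hz]) (by simp [hzz])
  have hr0 : r ≠ 0 := hr'.ne_zero 0
  rw [mul_neg, neg_inj] at hrz
  obtain ⟨s, s', hli, hs, hs', hsz, hsz'⟩ := ht.exists_linearIndependent_mul_eq_neg h2 hz hzz
  have hs0 : s ≠ 0 := hli.ne_zero 0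
  obtain ⟨H, h1, hH, hzH, hrH, -, hspan⟩ :=
    ht.exists_subalgebra_of_eigenvectors h2 hz hr hs hzz hrz hsz hr0 hs0
  obtain ⟨H', h1', hH', hzH', hrH', hsH', -⟩ :=
    ht.exists_subalgebra_of_eigenvectors h2 hz hr hs' hzz hrz hsz' hr0 (hli.ne_zero 1)
  obtain ⟨B, hB, hmem⟩ := ht.exists_block h2 h1 hH
  obtain ⟨B', hB', hmem'⟩ := ht.exists_block h2 h1' hH'
  have himag : ∀ x : O, t x = 0 → x ∈ imaginarySpace F O := fun x hx => by
    rwa [ht.imaginarySpace_eq h2]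
  have hpair : LinearIndependent F ![(⟨z, himag z hz⟩ : imaginarySpace F O), ⟨r, himag r hr⟩] := by
    rw [LinearIndependent.pair_iff]
    intro p q h
    have h' : p • z + q • r = 0 := congrArg Subtype.val h
    obtain ⟨-, h3, h4, -⟩ := ht.eq_zero_of_eigenvectors h2 hz hr hs hzz hrz hsz hr0 hs0
      (a := 0) (b := p) (c := q) (d := 0) (by rw [← h']; module)
    exact ⟨h3, h4⟩
  have hcard := hD.2.2.2 _ (finrank_span_pair hpair)
  rw [Nat.cast_one, Set.encard_eq_one] at hcard
  obtain ⟨C, hC⟩ := hcard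
  have hBC : B = C := by
    rw [← Set.mem_singleton_iff, ← hC]
    refine ⟨hB, ?_⟩
    rw [Submodule.span_le, Set.insert_subset_iff, Set.singleton_subset_iff]
    exact ⟨(hmem _).2 hzH, (hmem _).2 hrH⟩
  have hBC' : B' = C := by
    rw [← Set.mem_singleton_iff, ← hC]
    refine ⟨hB', ?_⟩
    rw [Submodule.span_le, Set.insert_subset_iff, Set.singleton_subset_iff]
    exact ⟨(hmem' _).2 hzH', (hmem' _).2 hrH'⟩
  have hsB : (⟨s', himag s' hs'⟩ : imaginarySpace F O) ∈ B := by
    rw [hBC, ← hBC']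
    exact (hmem' _).2 hsH'
  obtain ⟨p, q, u, v, h⟩ := hspan s' ((hmem _).1 hsB)
  have hne : s' - v • s ≠ 0 := fun h0 => by
    have := (LinearIndependent.pair_iff.1 hli (-v) 1 (by rw [← h0]; module)).2
    exact one_ne_zero this
  -- If both blocks agree, `s'` is a combination of `1`, `z`, `r`, `s`. Then the nonzero
  -- `-1`-eigenvector `s' - v s` is dependent on `1`, `z`, `r`.
  have := (ht.eq_zero_of_eigenvectors h2 hz hr (s := s' - v • s) (by simp [hs, hs']) hzz hrz
    (by rw [sub_mul, smul_mul_assoc, hsz, hsz']; module) hr0 hne (a := -p) (b := -q) (c := -u)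
    (d := 1) (by rw [h]; module)).2.2.2
  exact one_ne_zero this

end IsCayleyTrace

theorem theorem5 {F O : Type*} [Field F] [NonAssocRing O] [Module F O]
    [IsScalarTower F O O] [SMulCommClass F O O]
    (hF : ringChar F ≠ 2) (hO : IsCayleyAlgebra F O) :
    IsQCoveringDesign F (imaginarySpace F O) 7 3 2 (fourDimBlocks F O) ∧
    (∀ 𝓑' : Set (Submodule F (imaginarySpace F O)), 𝓑' ⊂ fourDimBlocks F O →
      ¬ IsQCoveringDesign F (imaginarySpace F O) 7 3 2 𝓑') ∧
    (IsSubspaceDesign F (imaginarySpace F O) 2 7 3 1 (fourDimBlocks F O) ↔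
      IsDivisionAlgebra O) := by
  have h2 : (2 : F) ≠ 0 := Ring.two_ne_zero hF
  obtain ⟨t, ht⟩ := hO.exists_isCayleyTrace h2
  exact ⟨ht.isQCoveringDesign h2, fun _ hS => ht.not_isQCoveringDesign_of_ssubset h2 hS,
    ht.isDivisionAlgebra_of_isSubspaceDesign h2, ht.isSubspaceDesign_of_isDivisionAlgebra h2⟩
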